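/- For each integer $j\ge 1$ let $f_j=\prod_{n=1}^{\infty}(1-q^{jn})$, regarded as a power series in $q$ with integer coefficients; it has constant term $1$, hence is invertible in $\mathbb{Z}[[q]]$. An eta quotient is a finite product $\prod_{j\ge1} f_j^{n_j}$ with exponents $n_j\in\mathbb{Z}$, only finitely many of them nonzero. Let $A(q)=\prod_{j\ge 1} f_j^{n_j}=\sum_{n\ge0}a_nq^n$ be any eta quotient such that $n_1$ is odd and $n_j$ is even for every odd $j>1$ (there is no condition on $n_j$ for even $j$). Let $$B(q)=A(q)\,\frac{f_1^2f_2}{f_4}=\sum_{n\ge0}b_nq^n .$$ Then for all integers $n\ge0$, $$a_{2n}\equiv b_{2n}\pmod 4,\qquad a_{2n+1}\equiv -b_{2n+1}\pmod 4 .$$ Consequently, for all integers $n\ge 0$, $$a_n\equiv0\pmod 4\iff b_n\equiv 0\pmod 4,\qquad a_n\equiv2\pmod 4\iff b_n\equiv 2\pmod 4 .$$ -/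

import Mathlib

open scoped PowerSeries.WithPiTopology

/-- The factors of `∏_{n ≥ 1} (1 - q ^ (j * n))` form a multipliable family of formal power series
(coefficientwise convergence, with `ℤ` discrete). -/
theorem multipliable_eulerFactor (j : ℕ+) :
    Multipliable fun n : ℕ ↦ (1 - PowerSeries.X ^ ((j : ℕ) * (n + 1)) : PowerSeries ℤ) := by
  simp_rw [sub_eq_add_neg]
  apply PowerSeries.WithPiTopology.multipliable_one_add_of_tendsto_order_atTop_nhds_top
  simp_rw [PowerSeries.order_neg, PowerSeries.order_X_pow]
  refine ENat.tendsto_nhds_top_iff_natCast_lt.mpr fun n ↦ Filter.eventually_atTop.mpr ⟨n, ?_⟩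
  intro m hm
  have hj : 1 ≤ (j : ℕ) := j.pos
  have h : n < (j : ℕ) * (m + 1) := by nlinarith
  exact_mod_cast h

/-- `f_j = ∏_{n ≥ 1} (1 - q ^ (j * n))` as a formal power series with integer coefficients; the
product index `n` is shifted by one. -/
noncomputable def eulerSeries (j : ℕ+) : PowerSeries ℤ :=
  ∏' n : ℕ, (1 - PowerSeries.X ^ ((j : ℕ) * (n + 1)))

theorem constantCoeff_eulerSeries (j : ℕ+) :
    PowerSeries.constantCoeff (eulerSeries j) = 1 := by
  rw [eulerSeries, (multipliable_eulerFactor j).map_tprod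
    (PowerSeries.constantCoeff (R := ℤ)) (PowerSeries.WithPiTopology.continuous_constantCoeff ℤ)]
  simp

theorem isUnit_eulerSeries (j : ℕ+) : IsUnit (eulerSeries j) := by
  rw [PowerSeries.isUnit_iff_constantCoeff, constantCoeff_eulerSeries]
  exact isUnit_one

/-- `f_j` as a unit of `ℤ⟦q⟧`, so that it has integer powers. -/
noncomputable def eulerUnit (j : ℕ+) : (PowerSeries ℤ)ˣ :=
  (isUnit_eulerSeries j).unit

/-- The eta quotient `∏_j f_j ^ (e j)`, a finite product with integer exponents `e j`. -/
noncomputable def etaQuotient (e : ℕ+ →₀ ℤ) : (PowerSeries ℤ)ˣ :=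
  e.prod fun j m ↦ eulerUnit j ^ m

/-!
Write `A(-q)` for the image of `A` under `q ↦ -q`. The claim is that `B ≡ A(-q)` modulo `4`, because
the coefficient of `q ^ n` in `A(-q)` is `(-1) ^ n * a n`.

The quotient `D(F) = F(-q) / F(q)`, reduced modulo `4`, is multiplicative in the unit `F`
(`negRatio`), so it suffices to know it on each `f_j`.

* If `j` is even, `f_j` is a series in `q ^ 2`, so `D(f_j) = 1`.
* For every `F`, the series `F(-q)` and `F(q)` agree modulo `2`, so their squares agree modulo `4`
  and `D(F) ^ 2 = 1` (`negRatio_sq`). Hence odd `j > 1`, having even exponents, contribute nothing,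
  and `f_1`, having odd exponent, contributes `D(f_1)`.

Thus `D(A) = D(f_1)`. Splitting the products into even and odd indices gives
`f_1(-q) * f_1 * f_4 = f_2 ^ 3` (`evalNegHom_eulerSeries_one_mul`), so
`D(f_1) = f_2 ^ 3 / (f_1 ^ 2 * f_4)`. Finally `f_1 ^ 2 ≡ f_2` modulo `2` by Frobenius, so
`f_1 ^ 4 ≡ f_2 ^ 2` modulo `4`, which turns this quotient into `f_1 ^ 2 * f_2 / f_4`.
-/

open PowerSeries

theorem multipliable_one_add_of_lt_order {f : ℕ → ℤ⟦X⟧} (hf : ∀ n : ℕ, (n : ℕ∞) < (f n).order) :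
    Multipliable fun n ↦ 1 + f n := by
  apply PowerSeries.WithPiTopology.multipliable_one_add_of_tendsto_order_atTop_nhds_top
  refine ENat.tendsto_nhds_top_iff_natCast_lt.mpr fun n ↦ Filter.eventually_atTop.mpr ⟨n, ?_⟩
  intro m hm
  exact lt_of_le_of_lt (by exact_mod_cast hm) (hf m)

theorem continuous_powerSeries_of_coeff {R S : Type*} [Semiring R] [Semiring S]
    [TopologicalSpace R] [TopologicalSpace S] {φ : R⟦X⟧ → S⟦X⟧}
    (h : ∀ n, Continuous fun f ↦ coeff n (φ f)) : Continuous φ :=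
  continuous_iff_continuousAt.mpr fun _ ↦
    (PowerSeries.WithPiTopology.tendsto_iff_coeff_tendsto _ _ _ _).mpr fun n ↦ (h n).continuousAt

theorem coeff_evalNegHom {R : Type*} [CommRing R] (f : R⟦X⟧) (n : ℕ) :
    coeff n (evalNegHom f) = (-1) ^ n * coeff n f := by
  simp [evalNegHom, coeff_rescale]

theorem continuous_evalNegHom : Continuous (evalNegHom : ℤ⟦X⟧ →+* ℤ⟦X⟧) :=
  continuous_powerSeries_of_coeff fun n ↦ by
    simp_rw [coeff_evalNegHom]
    exact continuous_const.mul (PowerSeries.WithPiTopology.continuous_coeff ℤ n)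

theorem continuous_map_intCast (N : ℕ) :
    Continuous (PowerSeries.map (Int.castRingHom (ZMod N))) :=
  continuous_powerSeries_of_coeff fun n ↦ by
    simp_rw [coeff_map]
    exact continuous_of_discreteTopology.comp (PowerSeries.WithPiTopology.continuous_coeff ℤ n)

/-! ### Euler products under `q ↦ -q` -/

theorem evalNegHom_eulerSeries (j : ℕ+) :
    evalNegHom (eulerSeries j) = ∏' n : ℕ, (1 - (-X) ^ ((j : ℕ) * (n + 1)) : ℤ⟦X⟧) := by
  rw [eulerSeries, (multipliable_eulerFactor j).map_tprod evalNegHom continuous_evalNegHom]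
  simp

theorem evalNegHom_eulerSeries_of_even {j : ℕ+} (hj : Even (j : ℕ)) :
    evalNegHom (eulerSeries j) = eulerSeries j := by
  rw [evalNegHom_eulerSeries, eulerSeries]
  simp_rw [(hj.mul_right _).neg_pow]

theorem multipliable_one_sub_X_pow_odd (c : ℕ) (hc : 0 < c) :
    Multipliable fun n : ℕ ↦ (1 - X ^ (c * (2 * n + 1)) : ℤ⟦X⟧) := by
  simp_rw [sub_eq_add_neg]
  refine multipliable_one_add_of_lt_order fun n ↦ ?_
  rw [order_neg, order_X_pow]
  exact_mod_cast (by nlinarith : n < c * (2 * n + 1))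

theorem multipliable_one_add_X_pow_odd :
    Multipliable fun n : ℕ ↦ (1 + X ^ (2 * n + 1) : ℤ⟦X⟧) := by
  refine multipliable_one_add_of_lt_order fun n ↦ ?_
  rw [order_X_pow]
  exact_mod_cast (by omega : n < 2 * n + 1)

/-- The factors of `f_c` with even index make up `f_{2c}`. -/
theorem tprod_odd_mul_eulerSeries (c d : ℕ+) (hd : (d : ℕ) = c * 2) :
    (∏' n : ℕ, (1 - X ^ ((c : ℕ) * (2 * n + 1)) : ℤ⟦X⟧)) * eulerSeries d = eulerSeries c := by
  have h : ∀ n : ℕ, (d : ℕ) * (n + 1) = c * (2 * n + 1 + 1) := fun n ↦ by rw [hd]; ring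
  have hm := multipliable_eulerFactor d
  simp_rw [h] at hm
  simp_rw [eulerSeries, h]
  exact tprod_even_mul_odd (f := fun n : ℕ ↦ (1 - X ^ ((c : ℕ) * (n + 1)) : ℤ⟦X⟧))
    (multipliable_one_sub_X_pow_odd c c.pos) hm

theorem tprod_odd_mul_eulerSeries_two :
    (∏' n : ℕ, (1 + X ^ (2 * n + 1) : ℤ⟦X⟧)) * eulerSeries 2 = evalNegHom (eulerSeries 1) := by
  have ho : ∀ n : ℕ, (1 + X ^ (2 * n + 1) : ℤ⟦X⟧) = 1 - (-X) ^ (2 * n + 1) := fun n ↦ by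
    rw [(odd_two_mul_add_one n).neg_pow]; ring
  have he : ∀ n : ℕ, (1 - X ^ (2 * (n + 1)) : ℤ⟦X⟧) = 1 - (-X) ^ (2 * n + 1 + 1) := fun n ↦ by
    rw [show 2 * n + 1 + 1 = 2 * (n + 1) by ring, (even_two_mul _).neg_pow]
  have hmo := multipliable_one_add_X_pow_odd
  have hme := multipliable_eulerFactor 2
  simp_rw [PNat.val_ofNat] at hme
  rw [evalNegHom_eulerSeries, eulerSeries]
  simp_rw [PNat.val_ofNat, one_mul]
  simp_rw [ho] at hmo ⊢
  simp_rw [he] at hme ⊢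
  exact tprod_even_mul_odd (f := fun n : ℕ ↦ (1 - (-X) ^ (n + 1) : ℤ⟦X⟧)) hmo hme

theorem tprod_one_add_mul_tprod_one_sub :
    (∏' n : ℕ, (1 + X ^ (2 * n + 1) : ℤ⟦X⟧)) * ∏' n : ℕ, (1 - X ^ (2 * n + 1) : ℤ⟦X⟧) =
      ∏' n : ℕ, (1 - X ^ (2 * (2 * n + 1)) : ℤ⟦X⟧) := by
  have hm := multipliable_one_sub_X_pow_odd 1 one_pos
  simp_rw [one_mul] at hm
  rw [← multipliable_one_add_X_pow_odd.tprod_mul hm]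
  exact tprod_congr fun n ↦ by ring

/-- The identity `f_1(-q) = f_2 ^ 3 / (f_1 * f_4)`, without denominators. -/
theorem evalNegHom_eulerSeries_one_mul :
    evalNegHom (eulerSeries 1) * (eulerSeries 1 * eulerSeries 4) = eulerSeries 2 ^ 3 := by
  have h1 := tprod_odd_mul_eulerSeries 1 2 rfl
  have h2 := tprod_odd_mul_eulerSeries 2 4 rfl
  simp_rw [PNat.one_coe, one_mul] at h1
  simp_rw [PNat.val_ofNat] at h2
  rw [← tprod_one_add_mul_tprod_one_sub] at h2
  rw [← tprod_odd_mul_eulerSeries_two]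
  rw [← h1]
  linear_combination eulerSeries 2 ^ 2 * h2

/-! ### Congruences modulo `2` and `4` -/

theorem map_sq_eq_of_map_eq {f g : ℤ⟦X⟧}
    (h : PowerSeries.map (Int.castRingHom (ZMod 2)) f =
      PowerSeries.map (Int.castRingHom (ZMod 2)) g) :
    PowerSeries.map (Int.castRingHom (ZMod 4)) f ^ 2 =
      PowerSeries.map (Int.castRingHom (ZMod 4)) g ^ 2 := by
  have hdvd : ∀ n, (2 : ℤ) ∣ coeff n f - coeff n g := fun n ↦ by
    have hn := congrArg (coeff n) h
    simp only [coeff_map, eq_intCast] at hn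
    exact (ZMod.intCast_eq_intCast_iff_dvd_sub _ _ 2).mp hn.symm
  choose z hz using hdvd
  have hf : f = g + 2 * PowerSeries.mk z := by
    ext n
    rw [map_add, show (2 : ℤ⟦X⟧) = C 2 from rfl, coeff_C_mul, coeff_mk, ← hz]
    ring
  have h4 : (4 : (ZMod 4)⟦X⟧) = 0 := by
    rw [show (4 : (ZMod 4)⟦X⟧) = C 4 from rfl, show (4 : ZMod 4) = 0 from rfl, map_zero]
  rw [hf, map_add, map_mul, map_ofNat]
  linear_combination (map (Int.castRingHom (ZMod 4)) g * map (Int.castRingHom (ZMod 4)) (mk z) +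
    map (Int.castRingHom (ZMod 4)) (mk z) ^ 2) * h4

theorem map_two_evalNegHom (f : ℤ⟦X⟧) :
    PowerSeries.map (Int.castRingHom (ZMod 2)) (evalNegHom f) =
      PowerSeries.map (Int.castRingHom (ZMod 2)) f := by
  ext n
  have h : (-1 : ZMod 2) = 1 := rfl
  simp [coeff_evalNegHom, h]

/-- `f_1 ^ 2 ≡ f_2` modulo `2`, since squaring is additive in characteristic `2`. -/
theorem map_two_eulerSeries_one_sq :
    PowerSeries.map (Int.castRingHom (ZMod 2)) (eulerSeries 1 ^ 2) =
      PowerSeries.map (Int.castRingHom (ZMod 2)) (eulerSeries 2) := by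
  have h2 : (2 : (ZMod 2)⟦X⟧) = 0 := by
    rw [show (2 : (ZMod 2)⟦X⟧) = C 2 from rfl, show (2 : ZMod 2) = 0 from rfl, map_zero]
  have hm := multipliable_eulerFactor 1
  rw [sq, eulerSeries, eulerSeries, ← hm.tprod_mul hm,
    (hm.mul hm).map_tprod _ (continuous_map_intCast 2),
    (multipliable_eulerFactor 2).map_tprod _ (continuous_map_intCast 2)]
  refine tprod_congr fun n ↦ ?_
  simp only [PNat.val_ofNat, one_mul, map_mul, map_sub, map_one, map_pow, map_X]
  linear_combination (X ^ (2 * (n + 1)) - X ^ (n + 1)) * h2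

/-! ### The ratio `F(-q) / F(q)` modulo `4` -/

/-- Reduction modulo `4` on units. -/
noncomputable def modFour : ℤ⟦X⟧ˣ →* (ZMod 4)⟦X⟧ˣ :=
  Units.map (PowerSeries.map (Int.castRingHom (ZMod 4)) : ℤ⟦X⟧ →* (ZMod 4)⟦X⟧)

/-- The substitution `q ↦ -q` on units. -/
noncomputable def evalNegUnit : ℤ⟦X⟧ˣ →* ℤ⟦X⟧ˣ :=
  Units.map ((evalNegHom : ℤ⟦X⟧ →+* ℤ⟦X⟧) : ℤ⟦X⟧ →* ℤ⟦X⟧)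

/-- The homomorphism sending a unit `F` to `F(-q) / F(q)` modulo `4`. -/
noncomputable def negRatio : ℤ⟦X⟧ˣ →* (ZMod 4)⟦X⟧ˣ :=
  modFour.comp evalNegUnit / modFour

theorem negRatio_apply (F : ℤ⟦X⟧ˣ) : negRatio F = modFour (evalNegUnit F) / modFour F := rfl

theorem negRatio_sq (F : ℤ⟦X⟧ˣ) : negRatio F ^ 2 = 1 := by
  rw [negRatio_apply, div_pow, div_eq_one]
  exact Units.ext (map_sq_eq_of_map_eq (map_two_evalNegHom F))

theorem negRatio_zpow_of_even (F : ℤ⟦X⟧ˣ) {m : ℤ} (hm : Even m) : negRatio F ^ m = 1 := by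
  obtain ⟨k, rfl⟩ := hm
  rw [← two_mul, zpow_mul, zpow_ofNat, negRatio_sq, one_zpow]

theorem negRatio_eulerUnit_of_even {j : ℕ+} (hj : Even (j : ℕ)) : negRatio (eulerUnit j) = 1 := by
  rw [negRatio_apply, div_eq_one]
  congr 1
  exact Units.ext (evalNegHom_eulerSeries_of_even hj)

theorem negRatio_eulerUnit_one :
    negRatio (eulerUnit 1) = modFour (eulerUnit 1 ^ 2 * eulerUnit 2 / eulerUnit 4) := by
  have h1 : evalNegUnit (eulerUnit 1) * (eulerUnit 1 * eulerUnit 4) = eulerUnit 2 ^ 3 :=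
    Units.ext evalNegHom_eulerSeries_one_mul
  have h2 : modFour (eulerUnit 1 ^ 2) ^ 2 = modFour (eulerUnit 2) ^ 2 :=
    Units.ext (map_sq_eq_of_map_eq map_two_eulerSeries_one_sq)
  rw [negRatio_apply, eq_mul_inv_of_mul_eq h1]
  simp only [map_mul, map_pow, map_inv, map_div] at h2 ⊢
  rw [div_eq_div_iff_mul_eq_mul, pow_succ, ← h2, mul_inv]
  generalize modFour (eulerUnit 1) = x
  generalize modFour (eulerUnit 4) = y
  generalize modFour (eulerUnit 2) = z
  calc (x ^ 2) ^ 2 * z * (x⁻¹ * y⁻¹) * y = x ^ 2 * z * x * (x * x⁻¹) * (y * y⁻¹) := by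
        simp only [pow_two]; ac_rfl
    _ = x ^ 2 * z * x := by simp

theorem negRatio_etaQuotient (e : ℕ+ →₀ ℤ) (h_one : Odd (e 1))
    (h_odd : ∀ j : ℕ+, 1 < j → Odd (j : ℕ) → Even (e j)) :
    negRatio (etaQuotient e) = negRatio (eulerUnit 1) := by
  have h_ne : e 1 ≠ 0 := fun h ↦ by simp [h] at h_one
  rw [etaQuotient, Finsupp.prod, map_prod,
    Finset.prod_eq_single_of_mem 1 (Finsupp.mem_support_iff.mpr h_ne), map_zpow]
  · obtain ⟨k, hk⟩ := h_one
    rw [hk, zpow_add, negRatio_zpow_of_even _ (even_two_mul k), one_mul, zpow_one]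
  · intro j _ hj
    rw [map_zpow]
    rcases Nat.even_or_odd (j : ℕ) with hp | hp
    · rw [negRatio_eulerUnit_of_even hp, one_zpow]
    · exact negRatio_zpow_of_even _ (h_odd j (lt_of_le_of_ne one_le hj.symm) hp)

theorem mainTheorem2 (e : ℕ+ →₀ ℤ) (h_one : Odd (e 1))
    (h_odd : ∀ j : ℕ+, 1 < j → Odd (j : ℕ) → Even (e j))
    (A B : (PowerSeries ℤ)ˣ) (hA : A = etaQuotient e)
    (hB : B = A * (eulerUnit 1 ^ 2 * eulerUnit 2 / eulerUnit 4))
    (a b : ℕ → ℤ) (ha : (A : PowerSeries ℤ) = PowerSeries.mk a)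
    (hb : (B : PowerSeries ℤ) = PowerSeries.mk b) :
    (∀ n : ℕ, a (2 * n) ≡ b (2 * n) [ZMOD 4]) ∧
    (∀ n : ℕ, a (2 * n + 1) ≡ -b (2 * n + 1) [ZMOD 4]) ∧
    (∀ n : ℕ, a n ≡ 0 [ZMOD 4] ↔ b n ≡ 0 [ZMOD 4]) ∧
    (∀ n : ℕ, a n ≡ 2 [ZMOD 4] ↔ b n ≡ 2 [ZMOD 4]) := by
  have hAB : modFour (evalNegUnit A) = modFour B := by
    rw [hB, map_mul, ← negRatio_eulerUnit_one, ← negRatio_etaQuotient e h_one h_odd, ← hA,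
      negRatio_apply, mul_div_cancel]
  have key : ∀ n, (-1) ^ n * a n ≡ b n [ZMOD 4] := fun n ↦ by
    have h : PowerSeries.map (Int.castRingHom (ZMod 4)) (evalNegHom (A : ℤ⟦X⟧)) =
        PowerSeries.map (Int.castRingHom (ZMod 4)) (B : ℤ⟦X⟧) := congrArg Units.val hAB
    have hn := congrArg (coeff n) h
    rw [ha, hb] at hn
    simp only [coeff_map, coeff_evalNegHom, coeff_mk, eq_intCast] at hn
    exact (ZMod.intCast_eq_intCast_iff _ _ 4).mp hn
  have h_even : ∀ n, a (2 * n) ≡ b (2 * n) [ZMOD 4] := fun n ↦ by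
    simpa using key (2 * n)
  have h_odd' : ∀ n, a (2 * n + 1) ≡ -b (2 * n + 1) [ZMOD 4] := fun n ↦ by
    simpa [pow_succ] using (key (2 * n + 1)).neg
  refine ⟨h_even, h_odd', fun n ↦ ?_, fun n ↦ ?_⟩ <;>
  · rcases Nat.even_or_odd' n with ⟨k, rfl | rfl⟩
    · have := h_even k
      unfold Int.ModEq at *
      omega
    · have := h_odd' k
      unfold Int.ModEq at *
      omega
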